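/- **Theorem.** Let $n\in\mathbb N$, $r>0$. A set-valued operator $A:\mathbb R^n\rightrightarrows\mathbb R^n$ is a *linear relation* if its graph $\operatorname{gra}A=\{(x,x^*):x^*\in Ax\}$ is a linear subspace of $\mathbb R^n\times\mathbb R^n$; it is *monotone* if $\langle x^*-y^*,x-y\rangle\ge 0$ for all $(x,x^*),(y,y^*)\in\operatorname{gra}A$, *maximally monotone* if it is monotone and no monotone operator has a graph properly containing $\operatorname{gra}A$, and *symmetric* if $\langle x,y^*\rangle=\langle y,x^*\rangle$ for all $(x,x^*),(y,y^*)\in\operatorname{gra}A$. Let $\mathcal A$ be the set of maximally monotone symmetric linear relations on $\mathbb R^n$. For $A\in\mathcal A$ let $q_A(x)=\tfrac12\langle x,x^*\rangle$ for any $x^*\in Ax$ if $Ax\ne\varnothing$ (the value does not depend on $x^*$), and $q_A(x)=\infty$ otherwise. Let $\Gamma_0(\mathbb R^n)$ be the set of proper, convex, lower semicontinuous functions $\mathbb R^n\to\mathbb R\cup\{\infty\}$, and put $$S=\{f=q_A(\cdot-a)+\langle b,\cdot\rangle+c:\ A\in\mathcal A,\ a,b\in\mathbb R^n,\ c\in\mathbb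 R,\ f\in\Gamma_0(\mathbb R^n)\},$$ $$T=\{f=q_A+\langle b,\cdot\rangle+c:\ A\in\mathcal A,\ b\in\mathbb R^n,\ c\in\mathbb R,\ f\in\Gamma_0(\mathbb R^n)\}.$$ Let $e_rf(x)=\inf_{y}\{f(y)+\tfrac r2\|y-x\|^2\}$ be the Moreau envelope, $f^*(y)=\sup_x\{\langle y,x\rangle-f(x)\}$ the Fenchel conjugate, and let $d$ be the Attouch–Wets metric $$d(f,g)=\sum_{i=1}^\infty\frac1{2^i}\,\frac{\sup_{\|x\|\le i}|e_rf(x)-e_rg(x)|}{1+\sup_{\|x\|\le i}|e_rf(x)-e_rg(x)|}.$$ Then: 1. $d$ is well defined on $S$ (for $f,g\in S$ the envelopes are finite, the suprema are finite and the series converges), it is a metric on $S$, and the metric space $(S,d)$ is complete. 2. If $f\in S$, then $f^*\in S$. 3. If $f\in S$ can be written as $f=q_A(\cdot-a)+c$ with $A\in\mathcal A$, $a\in\mathbb R^n$, $c\in\mathbb R$ (that is, with $b=0$), then $f^*\in T$. 4. If $f\in S$ and $\lambda>0$, then $\lambda f\in S$; if $f\in T$ and $\lambda>0$, then $\lambda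 f\in T$. 5. If $f_1,f_2\in T$, then $f_1+f_2\in T$. -/

import Mathlib

namespace GLQ

noncomputable section

/-- The Euclidean space of dimension `n`. -/
abbrev E (n : ℕ) : Type := EuclideanSpace ℝ (Fin n)

variable {n : ℕ}

/-! ### Set-valued operators, represented by their graphs -/

/-- A set-valued operator is a linear relation if its graph is a linear subspace. -/
def IsLinearRelation (A : SetRel (E n) (E n)) : Prop :=
  ∃ M : Submodule ℝ (E n × E n), (M : Set (E n × E n)) = A

/-- Monotonicity of a set-valued operator. -/
def IsMonotone (A : SetRel (E n) (E n)) : Prop :=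
  ∀ p ∈ A, ∀ p' ∈ A, 0 ≤ inner ℝ (p.2 - p'.2) (p.1 - p'.1)

/-- A monotone operator that is not properly contained in any monotone operator
(linear or not). -/
def IsMaximallyMonotone (A : SetRel (E n) (E n)) : Prop :=
  IsMonotone A ∧ ∀ B : SetRel (E n) (E n), IsMonotone B → A ⊆ B → B = A

/-- The adjoint: `(u, v)` is in its graph iff `⟨x, v⟩ = ⟨y, u⟩` for all `(x, y)` in the graph
of `A`. -/
def adjoint (A : SetRel (E n) (E n)) : SetRel (E n) (E n) :=
  {p | ∀ z ∈ A, inner ℝ z.1 p.2 = inner ℝ z.2 p.1}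

/-- `A` is symmetric if its graph is contained in the graph of its adjoint. -/
def IsSymmetric (A : SetRel (E n) (E n)) : Prop :=
  A ⊆ adjoint A

/-- The set of maximally monotone symmetric linear relations on `ℝⁿ`. -/
def MaxMonoSymLin (n : ℕ) : Set (SetRel (E n) (E n)) :=
  {A | IsLinearRelation A ∧ IsMaximallyMonotone A ∧ IsSymmetric A}

open Classical in
/-- `q_A(x) = ½⟨x, x*⟩`, for any `x* ∈ A x`, if `x ∈ dom A`, and `q_A(x) = ∞` otherwise.
For a monotone linear relation the value does not depend on the choice of `x*`;
see `qA_eq_of_mem`. -/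
def qA (A : SetRel (E n) (E n)) (x : E n) : EReal :=
  if h : ∃ y, (x, y) ∈ A then (((1 / 2 : ℝ) * inner ℝ x h.choose : ℝ) : EReal) else ⊤

theorem inner_eq_of_mem {A : SetRel (E n) (E n)} (hl : IsLinearRelation A)
    (hm : IsMonotone A) {x y z : E n} (hy : (x, y) ∈ A) (hz : (x, z) ∈ A) :
    inner ℝ x y = inner ℝ x z := by
  obtain ⟨M, rfl⟩ := hl
  have hd : ((0 : E n), y - z) ∈ M := by
    have := M.sub_mem hy hz
    simpa using this
  have key : ∀ t : ℝ, 0 ≤ inner ℝ x y - t * inner ℝ x (y - z) := by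
    intro t
    have h1 : ((0 : E n), t • (y - z)) ∈ M := by
      have := M.smul_mem t hd
      simpa using this
    have := hm (x, y) hy _ h1
    simp only [sub_zero] at this
    rw [real_inner_comm, inner_sub_right, real_inner_smul_right] at this
    exact this
  have h0 : inner ℝ x (y - z) = 0 := by
    by_contra hne
    have := key ((inner ℝ x y + 1) / inner ℝ x (y - z))
    rw [div_mul_cancel₀ _ hne] at this
    linarith
  rw [inner_sub_right] at h0
  linarith

theorem qA_eq_of_mem {A : SetRel (E n) (E n)} (hl : IsLinearRelation A)
    (hm : IsMonotone A) {x y : E n} (hy : (x, y) ∈ A) :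
    qA A x = (((1 / 2 : ℝ) * inner ℝ x y : ℝ) : EReal) := by
  have h : ∃ y, (x, y) ∈ A := ⟨y, hy⟩
  rw [qA, dif_pos h, inner_eq_of_mem hl hm h.choose_spec hy]

theorem qA_eq_top {A : SetRel (E n) (E n)} {x : E n} (hx : x ∉ A.dom) : qA A x = ⊤ := by
  rw [qA, dif_neg]
  exact hx

/-! ### Convex analysis of extended-real-valued functions -/

/-- `Γ₀(ℝⁿ)`: proper, convex, lower semicontinuous functions. Convexity is convexity of the
epigraph. -/
def Gamma0 (n : ℕ) : Set (E n → EReal) :=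
  {f | (∀ x, f x ≠ ⊥) ∧ (∃ x, f x ≠ ⊤) ∧
    Convex ℝ {p : E n × ℝ | f p.1 ≤ (p.2 : EReal)} ∧ LowerSemicontinuous f}

/-- The Fenchel conjugate. -/
def conjugate (f : E n → EReal) (y : E n) : EReal :=
  ⨆ x : E n, (((inner ℝ y x : ℝ) : EReal) - f x)

/-- The Moreau envelope `e_r f`. -/
def moreauEnv (r : ℝ) (f : E n → EReal) (x : E n) : EReal :=
  ⨅ y : E n, (f y + ((r / 2 * ‖y - x‖ ^ 2 : ℝ) : EReal))

/-- `|e_r f(x) - e_r g(x)|`; on `Γ₀(ℝⁿ)` the envelopes are finite. -/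
def envGap (r : ℝ) (f g : E n → EReal) (x : E n) : ℝ :=
  |(moreauEnv r f x).toReal - (moreauEnv r g x).toReal|

/-- `sup_{‖x‖ ≤ i} |e_r f(x) - e_r g(x)|`. -/
def envGapSup (r : ℝ) (f g : E n → EReal) (i : ℕ) : ℝ :=
  sSup (envGap r f g '' Metric.closedBall 0 (i : ℝ))

/-- The term of index `i` of the series defining the Attouch-Wets distance. -/
def awTerm (r : ℝ) (f g : E n → EReal) (i : ℕ) : ℝ :=
  1 / 2 ^ i * (envGapSup r f g i / (1 + envGapSup r f g i))

/-- The Attouch-Wets distance, the sum of the terms of index `1, 2, 3, …`. -/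
def awDist (r : ℝ) (f g : E n → EReal) : ℝ :=
  ∑' i : ℕ, awTerm r f g (i + 1)

/-! ### The classes of generalized linear-quadratic functions -/

/-- The function `q_A(· - a) + ⟨b, ·⟩ + c`. -/
def glq (A : SetRel (E n) (E n)) (a b : E n) (c : ℝ) (x : E n) : EReal :=
  qA A (x - a) + ((inner ℝ b x : ℝ) : EReal) + (c : EReal)

/-- The class `S`. -/
def S (n : ℕ) : Set (E n → EReal) :=
  {f | (∃ A ∈ MaxMonoSymLin n, ∃ (a b : E n) (c : ℝ), f = glq A a b c) ∧ f ∈ Gamma0 n}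

/-- The subclass `T` of `S`, where `a = 0`. -/
def T (n : ℕ) : Set (E n → EReal) :=
  {f | (∃ A ∈ MaxMonoSymLin n, ∃ (b : E n) (c : ℝ), f = glq A 0 b c) ∧ f ∈ Gamma0 n}

end

end GLQ

/-! The Moreau envelope identifies `S` with a set of finite quadratic functions. By the linear case
of Minty's theorem, a maximally monotone symmetric linear relation `A` is determined by its
resolvent `J = (I + A / r)⁻¹`, an everywhere defined, symmetric linear map with `⟨Jx, Jx⟩ ≤ ⟨Jx,
x⟩`, and every such `J` occurs (`exists_eq_resolventRel`, `resolventRel_mem_maxMonoSymLin`). After a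
translation along the graph of `A`, each member of `S` is `ofQuad r J p c`, with envelope `r/2 ⟨x, x
- Jx⟩ + ⟨p, x⟩ + c` (`exists_eq_ofQuad`, `moreauEnv_ofQuad`).

Polarization recovers `J`, `p`, `c` from values of this quadratic. Hence the envelope determines the
function, so `d` separates points, and pointwise limits of envelopes are again envelopes, because
the conditions on `J` are closed (`exists_eq_quad_of_tendsto`). Since `d` encodes uniform
convergence of envelopes on balls, completeness follows.

The algebraic claims are identities for `glq`: conjugation replaces `A` by its inverse and exchanges
`a` and `b`, while scaling and addition act on `A`. The new relations are maximal by a criterion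
special to linear relations, `IsLinearRelation.isMaximallyMonotone`. Membership in `Gamma0` is
automatic, since every `glq` is a conjugate of another one. -/

namespace GLQ

noncomputable section

variable {n : ℕ}

/-! ### Linear relations -/

section Relations

variable {A B : SetRel (E n) (E n)}

theorem IsLinearRelation.zero_mem (h : IsLinearRelation A) : ((0 : E n), (0 : E n)) ∈ A := by
  obtain ⟨M, rfl⟩ := h
  exact M.zero_mem

theorem IsLinearRelation.add_mem (h : IsLinearRelation A) {x y x' y' : E n}
    (h₁ : (x, y) ∈ A) (h₂ : (x', y') ∈ A) : (x + x', y + y') ∈ A := by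
  obtain ⟨M, rfl⟩ := h
  exact M.add_mem h₁ h₂

theorem IsLinearRelation.smul_mem (h : IsLinearRelation A) (t : ℝ) {x y : E n}
    (h₁ : (x, y) ∈ A) : (t • x, t • y) ∈ A := by
  obtain ⟨M, rfl⟩ := h
  exact M.smul_mem t h₁

theorem IsLinearRelation.sub_mem (h : IsLinearRelation A) {x y x' y' : E n}
    (h₁ : (x, y) ∈ A) (h₂ : (x', y') ∈ A) : (x - x', y - y') ∈ A := by
  obtain ⟨M, rfl⟩ := h
  exact M.sub_mem h₁ h₂

theorem IsLinearRelation.of_mem (h0 : ((0 : E n), (0 : E n)) ∈ A)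
    (hadd : ∀ x y x' y' : E n, (x, y) ∈ A → (x', y') ∈ A → (x + x', y + y') ∈ A)
    (hsmul : ∀ (t : ℝ) (x y : E n), (x, y) ∈ A → (t • x, t • y) ∈ A) : IsLinearRelation A :=
  ⟨{ carrier := A
     zero_mem' := h0
     add_mem' := fun {p q} hp hq => hadd p.1 p.2 q.1 q.2 hp hq
     smul_mem' := fun t p hp => hsmul t p.1 p.2 hp }, rfl⟩

theorem IsMonotone.inner_nonneg (hm : IsMonotone A) (hl : IsLinearRelation A) {x y : E n}
    (h : (x, y) ∈ A) : 0 ≤ inner ℝ y x := by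
  simpa using hm _ h _ hl.zero_mem

theorem IsLinearRelation.isMonotone (hl : IsLinearRelation A)
    (h : ∀ x y : E n, (x, y) ∈ A → 0 ≤ inner ℝ y x) : IsMonotone A :=
  fun _ hp _ hq => h _ _ (hl.sub_mem hp hq)

theorem IsSymmetric.inner_eq (hs : IsSymmetric A) {x y x' y' : E n} (h : (x, y) ∈ A)
    (h' : (x', y') ∈ A) : (inner ℝ x y' : ℝ) = inner ℝ y x' :=
  hs h' _ h

/-- A point monotonically related to a maximally monotone operator belongs to its graph. -/
theorem IsMaximallyMonotone.mem_of_forall (hA : IsMaximallyMonotone A) {u v : E n}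
    (h : ∀ x y : E n, (x, y) ∈ A → 0 ≤ inner ℝ (v - y) (u - x)) : (u, v) ∈ A := by
  have hB : IsMonotone (insert (u, v) A : SetRel (E n) (E n)) := by
    intro p hp p' hp'
    rcases hp with rfl | hp <;> rcases hp' with rfl | hp'
    · simp
    · exact h _ _ hp'
    · have := h _ _ hp
      rwa [← neg_sub v, ← neg_sub u, inner_neg_neg]
    · exact hA.1 _ hp _ hp'
  rw [← hA.2 _ hB (Set.subset_insert _ _)]
  exact Set.mem_insert _ _

/-- Testing `(0, w)` against `(x, y)` leaves `⟨y, x⟩ ≥ 0`. This is the converse of the criterion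
`IsLinearRelation.isMaximallyMonotone`. -/
theorem IsMaximallyMonotone.zero_mem_of_orthogonal (hA : IsMaximallyMonotone A)
    (hl : IsLinearRelation A) {w : E n} (h : ∀ x y : E n, (x, y) ∈ A → (inner ℝ w x : ℝ) = 0) :
    ((0 : E n), w) ∈ A := by
  refine hA.mem_of_forall fun x y hxy => ?_
  have := hA.1.inner_nonneg hl hxy
  rw [zero_sub, inner_neg_right, inner_sub_left, h x y hxy]
  linarith

/-- The discriminant is `b²` when `a * c = 0`. -/
theorem eq_zero_of_forall_quadratic_nonneg {a b c : ℝ}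
    (h : ∀ t : ℝ, 0 ≤ a * (t * t) + b * t + c) (hac : a * c = 0) : b = 0 := by
  have := discrim_le_zero h
  rw [discrim] at this
  nlinarith

/-- The domain of a linear relation is a linear subspace. -/
theorem exists_domain_submodule (hl : IsLinearRelation A) :
    ∃ D : Submodule ℝ (E n), ∀ x, x ∈ D ↔ ∃ y, (x, y) ∈ A := by
  obtain ⟨M, rfl⟩ := hl
  refine ⟨M.map (LinearMap.fst ℝ (E n) (E n)), fun x => ?_⟩
  simp

theorem IsLinearRelation.mem_dom_of_forall_orthogonal (hl : IsLinearRelation A) {u : E n}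
    (h : ∀ w : E n, (∀ x y : E n, (x, y) ∈ A → (inner ℝ w x : ℝ) = 0) →
      (inner ℝ w u : ℝ) = 0) : ∃ v, (u, v) ∈ A := by
  obtain ⟨D, hD⟩ := exists_domain_submodule hl
  rw [← hD, ← Submodule.orthogonal_orthogonal D, Submodule.mem_orthogonal]
  refine fun w hw => h w fun x y hxy => ?_
  rw [Submodule.mem_orthogonal'] at hw
  exact hw x ((hD x).2 ⟨y, hxy⟩)

/-- A monotone linear relation is maximally monotone as soon as the orthogonal complement of its
domain is contained in its multivalued part. -/
theorem IsLinearRelation.isMaximallyMonotone (hl : IsLinearRelation A) (hm : IsMonotone A)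
    (h : ∀ w : E n, (∀ x y : E n, (x, y) ∈ A → (inner ℝ w x : ℝ) = 0) → ((0 : E n), w) ∈ A) :
    IsMaximallyMonotone A := by
  refine ⟨hm, fun B hB hAB => Set.Subset.antisymm ?_ hAB⟩
  rintro ⟨u, v⟩ huv
  -- Testing `(u, v)` against `(0, t • w)` for all real `t` forces `u` to be orthogonal to every `w`
  -- in the orthogonal complement of the domain.
  obtain ⟨u', hu'⟩ : ∃ u', (u, u') ∈ A := by
    refine hl.mem_dom_of_forall_orthogonal fun w hw => ?_
    have hb : -(inner ℝ w u : ℝ) = 0 := by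
      refine eq_zero_of_forall_quadratic_nonneg (a := 0) (c := inner ℝ v u) (fun t => ?_) (by simp)
      have := hB _ huv _ (hAB (hl.smul_mem t (h w hw)))
      simp only [smul_zero, sub_zero, inner_sub_left, real_inner_smul_left] at this
      linarith
    linarith
  -- Testing against `(u + t • x, u' + t • y)` gives a quadratic in `t` without constant term, so
  -- its linear coefficient `-⟨v - u', x⟩` vanishes.
  have h0 : ((0 : E n), v - u') ∈ A := by
    refine h _ fun x y hxy => ?_
    have hb : -(inner ℝ (v - u') x : ℝ) = 0 := by
      refine eq_zero_of_forall_quadratic_nonneg (a := inner ℝ y x) (c := 0) (fun t => ?_) (by simp)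
      have := hB _ huv _ (hAB (hl.add_mem hu' (hl.smul_mem t hxy)))
      simp only [sub_add_cancel_left, inner_neg_right, real_inner_smul_right, inner_sub_left,
        inner_add_left, real_inner_smul_left] at this
      rw [inner_sub_left]
      linarith
    linarith
  simpa using hl.add_mem hu' h0

theorem MaxMonoSymLin.of_orthogonal (hl : IsLinearRelation A)
    (hm : ∀ x y : E n, (x, y) ∈ A → 0 ≤ inner ℝ y x) (hs : IsSymmetric A)
    (h : ∀ w : E n, (∀ x y : E n, (x, y) ∈ A → (inner ℝ w x : ℝ) = 0) → ((0 : E n), w) ∈ A) :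
    A ∈ MaxMonoSymLin n :=
  ⟨hl, hl.isMaximallyMonotone (hl.isMonotone hm) h, hs⟩

/-! ### Inverses, positive multiples and sums -/

theorem inv_mem_maxMonoSymLin (hA : A ∈ MaxMonoSymLin n) : A.inv ∈ MaxMonoSymLin n := by
  obtain ⟨hl, hm, hs⟩ := hA
  refine ⟨?_, ⟨?_, ?_⟩, ?_⟩
  · exact .of_mem hl.zero_mem (fun _ _ _ _ h h' => hl.add_mem h h')
      (fun t _ _ h => hl.smul_mem t h)
  · intro p hp q hq
    rw [real_inner_comm]
    exact hm.1 _ hp _ hq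
  · intro B hB hAB
    have := hm.2 B.inv (fun p hp q hq => by rw [real_inner_comm]; exact hB _ hp _ hq)
      (fun p hp => hAB hp)
    rw [← this]
    rfl
  · intro p hp q hq
    exact (hs.inner_eq (x := q.2) (y := q.1) (x' := p.2) (y' := p.1) hq hp).symm

/-- The relation `l A`. -/
def scaleRel (l : ℝ) (A : SetRel (E n) (E n)) : SetRel (E n) (E n) :=
  {p | ∃ y, (p.1, y) ∈ A ∧ p.2 = l • y}

theorem scaleRel_mem_maxMonoSymLin (hA : A ∈ MaxMonoSymLin n) {l : ℝ} (hl0 : 0 < l) :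
    scaleRel l A ∈ MaxMonoSymLin n := by
  obtain ⟨hl, hm, hs⟩ := hA
  refine .of_orthogonal ?_ ?_ ?_ ?_
  · refine .of_mem ⟨0, hl.zero_mem, by simp⟩ ?_ ?_
    · rintro x y x' y' ⟨z, hz, rfl⟩ ⟨z', hz', rfl⟩
      exact ⟨z + z', hl.add_mem hz hz', (smul_add _ _ _).symm⟩
    · rintro t x y ⟨z, hz, rfl⟩
      exact ⟨t • z, hl.smul_mem t hz, smul_comm _ _ _⟩
  · rintro x y ⟨z, hz, rfl⟩
    rw [real_inner_smul_left]
    exact mul_nonneg hl0.le (hm.1.inner_nonneg hl hz)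
  · rintro ⟨x, y⟩ ⟨z, hz, rfl⟩ ⟨x', y'⟩ ⟨z', hz', rfl⟩
    simp only at hz hz' ⊢
    rw [real_inner_smul_left, real_inner_smul_right, hs.inner_eq hz' hz]
  · intro w hw
    refine ⟨l⁻¹ • w, ?_, (smul_inv_smul₀ hl0.ne' w).symm⟩
    have := hl.smul_mem l⁻¹ (hm.zero_mem_of_orthogonal hl (w := w)
      fun x y hxy => hw x (l • y) ⟨y, hxy, rfl⟩)
    simpa using this

/-- The pointwise sum `A + B` of two relations. -/
def addRel (A B : SetRel (E n) (E n)) : SetRel (E n) (E n) :=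
  {p | ∃ y z, (p.1, y) ∈ A ∧ (p.1, z) ∈ B ∧ p.2 = y + z}

theorem addRel_mem_maxMonoSymLin (hA : A ∈ MaxMonoSymLin n) (hB : B ∈ MaxMonoSymLin n) :
    addRel A B ∈ MaxMonoSymLin n := by
  obtain ⟨hl, hm, hs⟩ := hA
  obtain ⟨hl', hm', hs'⟩ := hB
  refine .of_orthogonal ?_ ?_ ?_ ?_
  · refine .of_mem ⟨0, 0, hl.zero_mem, hl'.zero_mem, by simp⟩ ?_ ?_
    · rintro x y x' y' ⟨a, b, ha, hb, rfl⟩ ⟨a', b', ha', hb', rfl⟩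
      exact ⟨a + a', b + b', hl.add_mem ha ha', hl'.add_mem hb hb', add_add_add_comm _ _ _ _⟩
    · rintro t x y ⟨a, b, ha, hb, rfl⟩
      exact ⟨t • a, t • b, hl.smul_mem t ha, hl'.smul_mem t hb, smul_add _ _ _⟩
  · rintro x y ⟨a, b, ha, hb, rfl⟩
    rw [inner_add_left]
    exact add_nonneg (hm.1.inner_nonneg hl ha) (hm'.1.inner_nonneg hl' hb)
  · rintro ⟨x, y⟩ ⟨a, b, ha, hb, rfl⟩ ⟨x', y'⟩ ⟨a', b', ha', hb', rfl⟩
    simp only at ha hb ha' hb' ⊢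
    rw [inner_add_left, inner_add_right, hs.inner_eq ha' ha, hs'.inner_eq hb' hb]
  · intro w hw
    obtain ⟨D, hD⟩ := exists_domain_submodule hl
    obtain ⟨D', hD'⟩ := exists_domain_submodule hl'
    -- In finite dimension `(D ⊓ D')ᗮ = Dᗮ ⊔ D'ᗮ`, so the sum is maximal without any constraint
    -- qualification.
    have hw' : w ∈ Dᗮ ⊔ D'ᗮ := by
      rw [← Submodule.orthogonal_orthogonal (Dᗮ ⊔ D'ᗮ), ← Submodule.inf_orthogonal,
        Submodule.orthogonal_orthogonal, Submodule.orthogonal_orthogonal,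
        Submodule.mem_orthogonal']
      rintro x ⟨hx, hx'⟩
      obtain ⟨y, hy⟩ := (hD x).1 hx
      obtain ⟨y', hy'⟩ := (hD' x).1 hx'
      exact hw x _ ⟨y, y', hy, hy', rfl⟩
    obtain ⟨u, hu, v, hv, rfl⟩ := Submodule.mem_sup.1 hw'
    rw [Submodule.mem_orthogonal'] at hu hv
    exact ⟨u, v, hm.zero_mem_of_orthogonal hl fun x y h => hu x ((hD x).2 ⟨y, h⟩),
      hm'.zero_mem_of_orthogonal hl' fun x y h => hv x ((hD' x).2 ⟨y, h⟩), rfl⟩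

/-! ### Resolvents -/

/-- A symmetric firmly nonexpansive linear map. -/
structure IsFirm (J : E n →ₗ[ℝ] E n) : Prop where
  inner_comm : ∀ x y, (inner ℝ (J x) y : ℝ) = inner ℝ x (J y)
  firm : ∀ x, (inner ℝ (J x) (J x) : ℝ) ≤ inner ℝ (J x) x

theorem IsFirm.inner_nonneg {J : E n →ₗ[ℝ] E n} (hJ : IsFirm J) (x : E n) :
    0 ≤ (inner ℝ (J x) x : ℝ) :=
  real_inner_self_nonneg.trans (hJ.firm x)

/-- The relation `A` with resolvent `(I + A / r)⁻¹ = J`. -/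
def resolventRel (r : ℝ) (J : E n →ₗ[ℝ] E n) : SetRel (E n) (E n) :=
  {p | ∃ z, p = (J z, r • (z - J z))}

theorem resolventRel_mem_maxMonoSymLin {r : ℝ} (hr : 0 < r) {J : E n →ₗ[ℝ] E n}
    (hJ : IsFirm J) : resolventRel r J ∈ MaxMonoSymLin n := by
  have hl : IsLinearRelation (resolventRel r J) := by
    refine .of_mem ⟨0, by simp⟩ ?_ ?_
    · rintro x y x' y' ⟨z, hz⟩ ⟨z', hz'⟩
      cases hz; cases hz'
      exact ⟨z + z', by rw [map_add, ← smul_add, add_sub_add_comm]⟩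
    · rintro t x y ⟨z, hz⟩
      cases hz
      exact ⟨t • z, by rw [map_smul, smul_comm t r, ← smul_sub]⟩
  refine .of_orthogonal hl ?_ ?_ ?_
  · rintro x y ⟨z, hz⟩
    cases hz
    rw [real_inner_smul_left, inner_sub_left, real_inner_comm]
    exact mul_nonneg hr.le (sub_nonneg.2 (hJ.firm z))
  · rintro p ⟨z, rfl⟩ q ⟨z', rfl⟩
    simp only [map_smul, map_sub, real_inner_smul_left, real_inner_smul_right, inner_sub_left,
      inner_sub_right, hJ.inner_comm]
  · intro w hw
    refine ⟨r⁻¹ • w, ?_⟩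
    -- By symmetry `‖J z‖² = ⟨z, J (J z)⟩`, and `w` is orthogonal to the range of `J`.
    have h0 : J (r⁻¹ • w) = 0 := by
      rw [← inner_self_eq_zero (𝕜 := ℝ), ← hJ.inner_comm, real_inner_comm, real_inner_smul_left,
        hw _ _ ⟨_, rfl⟩, mul_zero]
    rw [h0, sub_zero, smul_inv_smul₀ hr.ne']

/-- The range of `I + A / r` is a subspace, so it suffices that its orthogonal complement is zero.
For `w` in that complement, `⟨r w - y, w - x⟩ = r‖w‖² + ⟨y, x⟩ ≥ 0` on `A`, so maximality puts `(w,
r • w)` in `A`. Then `w` is orthogonal to `w + w`. -/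
theorem exists_minty_decomposition {r : ℝ} (hr : 0 < r) (hl : IsLinearRelation A)
    (hm : IsMaximallyMonotone A) (z : E n) : ∃ x, (x, r • (z - x)) ∈ A := by
  have hlin : IsLinearRelation {p : E n × E n | (p.2, r • (p.1 - p.2)) ∈ A} := by
    refine .of_mem (by simpa using hl.zero_mem) ?_ ?_
    · intro x y x' y' h h'
      have := hl.add_mem h h'
      rwa [← smul_add, ← add_sub_add_comm] at this
    · intro t x y h
      have := hl.smul_mem t h
      rwa [smul_comm, smul_sub t] at this
  refine hlin.mem_dom_of_forall_orthogonal fun w hw => ?_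
  have hw' : ∀ x y : E n, (x, y) ∈ A → (inner ℝ w (x + r⁻¹ • y) : ℝ) = 0 := by
    intro x y h
    refine hw _ x ?_
    change (x, r • ((x + r⁻¹ • y) - x)) ∈ A
    rwa [add_sub_cancel_left, smul_inv_smul₀ hr.ne']
  have hmem : (w, r • w) ∈ A := by
    refine hm.mem_of_forall fun x y h => ?_
    have h1 := hw' x y h
    have h2 := hm.1.inner_nonneg hl h
    have h3 : (0 : ℝ) ≤ inner ℝ w w := real_inner_self_nonneg
    have h4 : r * (inner ℝ w x : ℝ) + inner ℝ w y = 0 := by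
      rw [inner_add_right, real_inner_smul_right] at h1
      field_simp at h1
      linarith
    simp only [inner_sub_left, inner_sub_right, real_inner_smul_left]
    rw [real_inner_comm w y]
    nlinarith
  have h1 := hw' _ _ hmem
  rw [inv_smul_smul₀ hr.ne', inner_add_right, add_self_eq_zero, inner_self_eq_zero] at h1
  simp [h1]

theorem exists_eq_resolventRel {r : ℝ} (hr : 0 < r) (hA : A ∈ MaxMonoSymLin n) :
    ∃ J : E n →ₗ[ℝ] E n, IsFirm J ∧ A = resolventRel r J := by
  obtain ⟨hl, hm, hs⟩ := hA
  choose j hj using exists_minty_decomposition hr hl hm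
  -- Monotonicity makes the decomposition unique, and uniqueness makes `j` linear.
  have huniq : ∀ x z, (x, r • (z - x)) ∈ A → x = j z := by
    intro x z h
    have := hm.1 _ h _ (hj z)
    simp only at this
    rw [← smul_sub, real_inner_smul_left, sub_sub_sub_cancel_left, ← neg_sub x (j z),
      inner_neg_left, mul_neg] at this
    have h2 : (0 : ℝ) ≤ inner ℝ (x - j z) (x - j z) := real_inner_self_nonneg
    have h3 : (inner ℝ (x - j z) (x - j z) : ℝ) = 0 := by nlinarith
    exact sub_eq_zero.1 (inner_self_eq_zero.1 h3)
  let J : E n →ₗ[ℝ] E n :=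
    { toFun := j
      map_add' := fun x y => by
        refine (huniq _ _ ?_).symm
        have := hl.add_mem (hj x) (hj y)
        rwa [← smul_add, ← add_sub_add_comm] at this
      map_smul' := fun t x => by
        refine (huniq _ _ ?_).symm
        have := hl.smul_mem t (hj x)
        rwa [smul_comm, smul_sub t] at this }
  refine ⟨J, ⟨fun x y => ?_, fun x => ?_⟩, ?_⟩
  · have h := hs.inner_eq (hj x) (hj y)
    simp only [real_inner_smul_left, real_inner_smul_right, inner_sub_left,
      inner_sub_right] at h
    have := mul_left_cancel₀ hr.ne' h
    change (inner ℝ (j x) y : ℝ) = inner ℝ x (j y)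
    linarith
  · have h := hm.1.inner_nonneg hl (hj x)
    rw [real_inner_smul_left, inner_sub_left, real_inner_comm] at h
    exact sub_nonneg.1 (nonneg_of_mul_nonneg_right h hr)
  · ext ⟨x, y⟩
    constructor
    · intro h
      refine ⟨x + r⁻¹ • y, ?_⟩
      have hx : x = J (x + r⁻¹ • y) := huniq _ _ (by
        rwa [add_sub_cancel_left, smul_inv_smul₀ hr.ne'])
      rw [← hx, add_sub_cancel_left, smul_inv_smul₀ hr.ne']
    · rintro ⟨z, hz⟩
      rw [hz]
      exact hj z

end Relations

/-! ### Generalized linear-quadratic functions -/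

section Functions

variable {A B : SetRel (E n) (E n)}

theorem glq_of_mem (hA : A ∈ MaxMonoSymLin n) {a x u : E n} (b : E n) (c : ℝ)
    (h : (x - a, u) ∈ A) :
    glq A a b c x = ((1 / 2 * inner ℝ (x - a) u + inner ℝ b x + c : ℝ) : EReal) := by
  rw [glq, qA_eq_of_mem hA.1 hA.2.1.1 h]
  norm_cast

theorem glq_of_forall_notMem {a x : E n} (b : E n) (c : ℝ) (h : ¬ ∃ u, (x - a, u) ∈ A) :
    glq A a b c x = ⊤ := by
  rw [glq, qA_eq_top h, EReal.top_add_coe, EReal.top_add_coe]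

theorem glq_ne_bot (hA : A ∈ MaxMonoSymLin n) (a b : E n) (c : ℝ) (x : E n) :
    glq A a b c x ≠ ⊥ := by
  by_cases h : ∃ u, (x - a, u) ∈ A
  · obtain ⟨u, hu⟩ := h
    rw [glq_of_mem hA b c hu]
    exact EReal.coe_ne_bot _
  · rw [glq_of_forall_notMem b c h]
    exact top_ne_bot

/-! ### Fenchel conjugates -/

theorem convex_epigraph_conjugate {f : E n → EReal} (hf : ∀ x, f x ≠ ⊥) :
    Convex ℝ {p : E n × ℝ | conjugate f p.1 ≤ (p.2 : EReal)} := by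
  have : {p : E n × ℝ | conjugate f p.1 ≤ (p.2 : EReal)} =
      ⋂ x : E n, {p | ((inner ℝ p.1 x : ℝ) : EReal) - f x ≤ (p.2 : EReal)} := by
    ext p
    simp [conjugate]
  rw [this]
  refine convex_iInter fun x => ?_
  rcases eq_or_ne (f x) ⊤ with h | h
  · simpa [h] using convex_univ
  · lift f x to ℝ using ⟨h, hf x⟩ with t
    intro p hp q hq s t' hs ht hst
    simp only [Set.mem_ofPred_eq, ← EReal.coe_sub, EReal.coe_le_coe_iff, Prod.fst_add,
      Prod.snd_add, Prod.smul_fst, Prod.smul_snd, inner_add_left, real_inner_smul_left,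
      smul_eq_mul] at hp hq ⊢
    obtain rfl : t' = 1 - s := by linarith
    nlinarith [mul_le_mul_of_nonneg_left hp hs, mul_le_mul_of_nonneg_left hq ht]

theorem lowerSemicontinuous_conjugate {f : E n → EReal} (hf : ∀ x, f x ≠ ⊥) :
    LowerSemicontinuous (conjugate f) := by
  refine lowerSemicontinuous_iSup fun x => Continuous.lowerSemicontinuous ?_
  rcases eq_or_ne (f x) ⊤ with h | h
  · simpa [h] using continuous_const
  · lift f x to ℝ using ⟨h, hf x⟩ with t
    simp only [← EReal.coe_sub]
    exact continuous_coe_real_ereal.comp (by fun_prop)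

/-- If `y - b` lies in the range of `A`, monotonicity and symmetry bound the supremum, with equality
at `x = a + u`. Otherwise some `w` orthogonal to the range has `⟨w, y - b⟩ ≠ 0`. Maximality of the
inverse gives `(w, 0) ∈ A`, so the expression is affine and nonconstant along `a + s • w`, hence
unbounded. -/
theorem conjugate_glq (hA : A ∈ MaxMonoSymLin n) (a b : E n) (c : ℝ) :
    conjugate (glq A a b c) = glq A.inv b a (-inner ℝ a b - c) := by
  have hA' := inv_mem_maxMonoSymLin hA
  funext y
  by_cases h : ∃ u, (y - b, u) ∈ A.inv
  · obtain ⟨u, hu⟩ := h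
    rw [glq_of_mem hA' _ _ hu]
    refine le_antisymm (iSup_le fun x => ?_) ?_
    · by_cases hx : ∃ v, (x - a, v) ∈ A
      · obtain ⟨v, hv⟩ := hx
        rw [glq_of_mem hA _ _ hv, ← EReal.coe_sub, EReal.coe_le_coe_iff]
        have h1 := hA.2.1.1 _ hv (u, y - b) hu
        have h2 := hA.2.2.inner_eq (x' := u) (y' := y - b) hv hu
        simp only [inner_sub_left, inner_sub_right] at h1 h2 ⊢
        simp only [real_inner_comm v, real_inner_comm y, real_inner_comm b] at *
        linarith
      · rw [glq_of_forall_notMem _ _ hx, EReal.sub_top]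
        exact bot_le
    · refine le_iSup_of_le (a + u) ?_
      have hv : (a + u - a, y - b) ∈ A := by rwa [add_sub_cancel_left]
      rw [glq_of_mem hA _ _ hv, ← EReal.coe_sub, EReal.coe_le_coe_iff, add_sub_cancel_left]
      simp only [inner_sub_left, inner_sub_right, inner_add_right]
      simp only [real_inner_comm u, real_inner_comm a]
      linarith
  · rw [glq_of_forall_notMem _ _ h]
    have := mt (hA'.1.mem_dom_of_forall_orthogonal (u := y - b)) h
    push Not at this
    obtain ⟨w, hw, hwy⟩ := this
    have hw0 : (w, (0 : E n)) ∈ A := hA'.2.1.zero_mem_of_orthogonal hA'.1 hw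
    rw [EReal.eq_top_iff_forall_lt]
    intro t
    -- Chosen so that the expression under the supremum equals `t + 1` at `a + s • w`.
    set s : ℝ := (t + 1 - (inner ℝ y a - inner ℝ b a - c)) / inner ℝ w (y - b) with hs
    have hs' : s * inner ℝ w (y - b) = t + 1 - (inner ℝ y a - inner ℝ b a - c) :=
      div_mul_cancel₀ _ hwy
    refine lt_of_lt_of_le ?_ (le_iSup _ (a + s • w))
    have hv : (a + s • w - a, s • (0 : E n)) ∈ A := by
      rw [add_sub_cancel_left]
      exact hA.1.smul_mem s hw0
    rw [glq_of_mem hA _ _ hv, ← EReal.coe_sub, EReal.coe_lt_coe_iff]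
    simp only [inner_sub_right, inner_add_right, real_inner_smul_right, smul_zero,
      inner_zero_right] at hs' ⊢
    simp only [real_inner_comm w] at hs' ⊢
    linarith

/-- Inverting `A` twice returns `A`, so the conjugation formula exhibits the function as a
conjugate, that is, a supremum of affine functions. -/
theorem glq_mem_Gamma0 (hA : A ∈ MaxMonoSymLin n) (a b : E n) (c : ℝ) :
    glq A a b c ∈ Gamma0 n := by
  have hA' := inv_mem_maxMonoSymLin hA
  have key : glq A a b c = conjugate (glq A.inv b a (-inner ℝ a b - c)) := by
    rw [conjugate_glq hA', real_inner_comm]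
    congr 1
    ring
  refine ⟨glq_ne_bot hA a b c, ⟨a, ?_⟩, ?_, ?_⟩
  · rw [glq_of_mem hA (u := 0) b c (by simpa using hA.1.zero_mem)]
    exact EReal.coe_ne_top _
  · rw [key]
    exact convex_epigraph_conjugate (glq_ne_bot hA' _ _ _)
  · rw [key]
    exact lowerSemicontinuous_conjugate (glq_ne_bot hA' _ _ _)

theorem glq_mem_S (hA : A ∈ MaxMonoSymLin n) (a b : E n) (c : ℝ) : glq A a b c ∈ S n :=
  ⟨⟨A, hA, a, b, c, rfl⟩, glq_mem_Gamma0 hA a b c⟩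

theorem glq_mem_T (hA : A ∈ MaxMonoSymLin n) (b : E n) (c : ℝ) : glq A 0 b c ∈ T n :=
  ⟨⟨A, hA, b, c, rfl⟩, glq_mem_Gamma0 hA 0 b c⟩

theorem mul_glq (hA : A ∈ MaxMonoSymLin n) (a b : E n) (c : ℝ) {l : ℝ} (hl : 0 < l) :
    (fun x => (l : EReal) * glq A a b c x) = glq (scaleRel l A) a (l • b) (l * c) := by
  funext x
  by_cases h : ∃ u, (x - a, u) ∈ A
  · obtain ⟨u, hu⟩ := h
    have hu' : (x - a, l • u) ∈ scaleRel l A := ⟨u, hu, rfl⟩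
    rw [glq_of_mem hA _ _ hu, glq_of_mem (scaleRel_mem_maxMonoSymLin hA hl) _ _ hu',
      ← EReal.coe_mul, real_inner_smul_left, real_inner_smul_right]
    congr 1
    ring
  · have h' : ¬ ∃ u, (x - a, u) ∈ scaleRel l A := fun ⟨_, v, hv, _⟩ => h ⟨v, hv⟩
    rw [glq_of_forall_notMem _ _ h, glq_of_forall_notMem _ _ h', EReal.coe_mul_top_of_pos hl]

/-- The common center `a` matters: with different centers the two domains can be disjoint, and the
sum is then identically `⊤`. -/
theorem glq_add_glq (hA : A ∈ MaxMonoSymLin n) (hB : B ∈ MaxMonoSymLin n) (a b b' : E n)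
    (c c' : ℝ) :
    (fun x => glq A a b c x + glq B a b' c' x) = glq (addRel A B) a (b + b') (c + c') := by
  funext x
  by_cases h : ∃ u, (x - a, u) ∈ A
  · obtain ⟨u, hu⟩ := h
    by_cases h' : ∃ u, (x - a, u) ∈ B
    · obtain ⟨u', hu'⟩ := h'
      have hv : (x - a, u + u') ∈ addRel A B := ⟨u, u', hu, hu', rfl⟩
      rw [glq_of_mem hA _ _ hu, glq_of_mem hB _ _ hu',
        glq_of_mem (addRel_mem_maxMonoSymLin hA hB) _ _ hv, ← EReal.coe_add, inner_add_left,
        inner_add_right]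
      congr 1
      ring
    · have h'' : ¬ ∃ u, (x - a, u) ∈ addRel A B := fun ⟨_, _, v, _, hv, _⟩ => h' ⟨v, hv⟩
      rw [glq_of_forall_notMem _ _ h', glq_of_forall_notMem _ _ h'',
        EReal.add_top_of_ne_bot (glq_ne_bot hA _ _ _ _)]
  · have h'' : ¬ ∃ u, (x - a, u) ∈ addRel A B := fun ⟨_, v, _, hv, _⟩ => h ⟨v, hv⟩
    rw [glq_of_forall_notMem _ _ h, glq_of_forall_notMem _ _ h'',
      EReal.top_add_of_ne_bot (glq_ne_bot hB _ _ _ _)]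

/-- Translating along a point of the graph of `A` changes `q_A` by an affine function. -/
theorem glq_eq_glq_sub (hA : A ∈ MaxMonoSymLin n) (a b : E n) (c : ℝ) {v v' : E n}
    (hv : (v, v') ∈ A) :
    glq A a b c = glq A (a - v) (b - v') (c + inner ℝ a v' - 1 / 2 * inner ℝ v v') := by
  funext x
  have hx : x - (a - v) = x - a + v := by abel
  by_cases h : ∃ u, (x - a, u) ∈ A
  · obtain ⟨u, hu⟩ := h
    have hu' := hA.1.add_mem hu hv
    have hs := hA.2.2.inner_eq hv hu
    rw [← hx] at hu'
    rw [glq_of_mem hA _ _ hu, glq_of_mem hA _ _ hu', hx]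
    congr 1
    simp only [inner_sub_left, inner_sub_right, inner_add_left, inner_add_right] at hs ⊢
    simp only [real_inner_comm v'] at hs ⊢
    linarith
  · have h' : ¬ ∃ u, (x - (a - v), u) ∈ A := by
      rintro ⟨u, hu⟩
      refine h ⟨u - v', ?_⟩
      have := hA.1.sub_mem hu hv
      rwa [hx, add_sub_cancel_right] at this
    rw [glq_of_forall_notMem _ _ h, glq_of_forall_notMem _ _ h']

/-! ### Moreau envelopes -/

/-- A quadratic function; for `J` firmly nonexpansive it is a Moreau envelope. -/
def quad (r : ℝ) (J : E n →ₗ[ℝ] E n) (p : E n) (c : ℝ) (x : E n) : ℝ :=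
  r / 2 * inner ℝ x (x - J x) + inner ℝ p x + c

/-- The generalized linear-quadratic function with Moreau envelope `quad r J p c`. -/
def ofQuad (r : ℝ) (J : E n →ₗ[ℝ] E n) (p : E n) (c : ℝ) : E n → EReal :=
  glq (resolventRel r J) (-(r⁻¹ • p)) p (c + r⁻¹ / 2 * inner ℝ p p)

variable {r : ℝ}

theorem ofQuad_mem_S (hr : 0 < r) {J : E n →ₗ[ℝ] E n} (hJ : IsFirm J) (p : E n) (c : ℝ) :
    ofQuad r J p c ∈ S n :=
  glq_mem_S (resolventRel_mem_maxMonoSymLin hr hJ) _ _ _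

theorem exists_eq_ofQuad (hr : 0 < r) {f : E n → EReal} (hf : f ∈ S n) :
    ∃ J : E n →ₗ[ℝ] E n, IsFirm J ∧ ∃ p c, f = ofQuad r J p c := by
  obtain ⟨⟨A, hA, a, b, c, rfl⟩, -⟩ := hf
  obtain ⟨J, hJ, rfl⟩ := exists_eq_resolventRel hr hA
  -- Translating by `(v, v')` reaches the form `ofQuad` when `a - v = -r⁻¹ • (b - v')`, that is,
  -- when `v + r⁻¹ • v'` equals this `s`. The Minty decomposition of `s` supplies such a pair in the
  -- graph.
  set s := a + r⁻¹ • b with hs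
  have hv : (J s, r • (s - J s)) ∈ resolventRel r J := ⟨s, rfl⟩
  refine ⟨J, hJ, b - r • (s - J s),
    c + inner ℝ a (r • (s - J s)) - 1 / 2 * inner ℝ (J s) (r • (s - J s)) -
      r⁻¹ / 2 * inner ℝ (b - r • (s - J s)) (b - r • (s - J s)), ?_⟩
  rw [glq_eq_glq_sub hA a b c hv, ofQuad]
  congr 1
  · rw [smul_sub, inv_smul_smul₀ hr.ne']
    nth_rw 2 [hs]
    abel
  · exact (sub_add_cancel _ _).symm

/-- Points of the domain have the form `J s - r⁻¹ • p`. There the objective is `quad r J p c x` plus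
`r/2 ⟨J (s - x), s - x⟩`, which is nonnegative and vanishes at `s = x`. -/
theorem moreauEnv_ofQuad (hr : 0 < r) {J : E n →ₗ[ℝ] E n} (hJ : IsFirm J) (p : E n) (c : ℝ)
    (x : E n) : moreauEnv r (ofQuad r J p c) x = (quad r J p c x : EReal) := by
  have hA := resolventRel_mem_maxMonoSymLin hr hJ
  have key : ∀ s : E n, ofQuad r J p c (J s - r⁻¹ • p) +
      ((r / 2 * ‖J s - r⁻¹ • p - x‖ ^ 2 : ℝ) : EReal) =
      ((quad r J p c x + r / 2 * inner ℝ (J (s - x)) (s - x) : ℝ) : EReal) := by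
    intro s
    have hv : (J s - r⁻¹ • p - -(r⁻¹ • p), r • (s - J s)) ∈ resolventRel r J :=
      ⟨s, by rw [sub_neg_eq_add, sub_add_cancel]⟩
    rw [ofQuad, glq_of_mem hA _ _ hv, ← EReal.coe_add, ← real_inner_self_eq_norm_sq, quad]
    congr 1
    simp only [sub_neg_eq_add, sub_add_cancel, inner_sub_left, inner_sub_right,
      real_inner_smul_left, real_inner_smul_right, map_sub]
    rw [hJ.inner_comm x s, real_inner_comm x (J s), real_inner_comm p (J s),
      real_inner_comm p x, real_inner_comm (J x) x]
    field_simp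
    ring
  refine le_antisymm ?_ (le_iInf fun y => ?_)
  · refine iInf_le_of_le (J x - r⁻¹ • p) ?_
    rw [key, sub_self, map_zero, inner_zero_left, mul_zero, add_zero]
  · by_cases h : ∃ u, (y - -(r⁻¹ • p), u) ∈ resolventRel r J
    · obtain ⟨u, s, hs⟩ := h
      have hy : y = J s - r⁻¹ • p := by
        rw [← (Prod.mk.inj hs).1]
        abel
      rw [hy, key, EReal.coe_le_coe_iff]
      have := hJ.inner_nonneg (s - x)
      nlinarith
    · rw [ofQuad, glq_of_forall_notMem _ _ h, EReal.top_add_coe]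
      exact le_top

end Functions

/-! ### Limits of quadratic functions -/

section Quad

open Filter Topology

variable {r : ℝ}

theorem quad_zero (J : E n →ₗ[ℝ] E n) (p : E n) (c : ℝ) : quad r J p c 0 = c := by
  simp [quad]

theorem continuous_quad (J : E n →ₗ[ℝ] E n) (p : E n) (c : ℝ) : Continuous (quad r J p c) := by
  have := J.continuous_of_finiteDimensional
  unfold quad
  fun_prop

/-- The linear term is the odd part of the quadratic. -/
theorem inner_eq_quad (J : E n →ₗ[ℝ] E n) (p : E n) (c : ℝ) (x : E n) :
    (inner ℝ x p : ℝ) = (quad r J p c x - quad r J p c (-x)) / 2 := by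
  simp only [quad, map_neg, inner_neg_left, inner_neg_right, inner_sub_right, real_inner_comm p]
  ring

/-- Polarization: since `J` is symmetric, the second difference of `quad` is `r ⟨x, y - J y⟩`. -/
theorem IsFirm.inner_eq_quad (hr : 0 < r) {J : E n →ₗ[ℝ] E n} (hJ : IsFirm J) (p : E n) (c : ℝ)
    (x y : E n) : (inner ℝ x (J y) : ℝ) = inner ℝ x y -
      (quad r J p c (x + y) - quad r J p c x - quad r J p c y + quad r J p c 0) / r := by
  rw [quad_zero]
  simp only [quad, map_add, inner_add_left, inner_add_right, inner_sub_right]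
  rw [real_inner_comm x y, real_inner_comm (J x) y, hJ.inner_comm x y]
  field_simp
  ring

theorem quad_injective (hr : 0 < r) {J J' : E n →ₗ[ℝ] E n} (hJ : IsFirm J) (hJ' : IsFirm J')
    {p p' : E n} {c c' : ℝ} (h : quad r J p c = quad r J' p' c') : J = J' ∧ p = p' ∧ c = c' := by
  refine ⟨LinearMap.ext fun y => ext_inner_left ℝ fun x => ?_, ext_inner_left ℝ fun x => ?_, ?_⟩
  · rw [hJ.inner_eq_quad hr p c, hJ'.inner_eq_quad hr p' c', h]
  · rw [inner_eq_quad (r := r) J p c, inner_eq_quad (r := r) J' p' c', h]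
  · rw [← quad_zero (r := r) J p c, ← quad_zero (r := r) J' p' c', h]

/-- In finite dimension weak convergence is convergence of coordinates in an orthonormal basis. -/
theorem exists_tendsto_of_forall_inner {v : ℕ → E n}
    (h : ∀ x : E n, ∃ l : ℝ, Tendsto (fun k => (inner ℝ x (v k) : ℝ)) atTop (𝓝 l)) :
    ∃ z, Tendsto v atTop (𝓝 z) := by
  choose l hl using h
  let b := EuclideanSpace.basisFun (Fin n) ℝ
  refine ⟨∑ i, l (b i) • b i, ?_⟩
  have hv : v = fun k => ∑ i, (inner ℝ (b i) (v k) : ℝ) • b i :=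
    funext fun k => (b.sum_repr' (v k)).symm
  rw [hv]
  exact tendsto_finsetSum _ fun i _ => (hl (b i)).smul_const _

/-- A pointwise limit of Moreau envelopes of functions in `S` is again of this form. -/
theorem exists_eq_quad_of_tendsto (hr : 0 < r) {J : ℕ → E n →ₗ[ℝ] E n} (hJ : ∀ k, IsFirm (J k))
    {p : ℕ → E n} {c : ℕ → ℝ} {h : E n → ℝ}
    (hh : ∀ x, Tendsto (fun k => quad r (J k) (p k) (c k) x) atTop (𝓝 (h x))) :
    ∃ J' : E n →ₗ[ℝ] E n, IsFirm J' ∧ ∃ p' c', h = quad r J' p' c' := by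
  have h1 : ∀ y, ∃ z, Tendsto (fun k => J k y) atTop (𝓝 z) := by
    refine fun y => exists_tendsto_of_forall_inner fun x => ?_
    simp_rw [fun k => (hJ k).inner_eq_quad hr (p k) (c k) x y]
    exact ⟨_, (((((hh (x + y)).sub (hh x)).sub (hh y)).add (hh 0)).div_const r).const_sub _⟩
  choose j hj using h1
  obtain ⟨p', hp'⟩ : ∃ z, Tendsto p atTop (𝓝 z) := by
    refine exists_tendsto_of_forall_inner fun x => ?_
    simp_rw [fun k => inner_eq_quad (r := r) (J k) (p k) (c k) x]
    exact ⟨_, ((hh x).sub (hh (-x))).div_const 2⟩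
  have hc : Tendsto c atTop (𝓝 (h 0)) := by simpa only [quad_zero] using hh 0
  let J' : E n →ₗ[ℝ] E n := linearMapOfTendsto j J (tendsto_pi_nhds.2 hj)
  have hJ' : ∀ y, Tendsto (fun k => J k y) atTop (𝓝 (J' y)) := hj
  refine ⟨J', ⟨fun x y => ?_, fun x => ?_⟩, p', h 0, funext fun x => ?_⟩
  · refine tendsto_nhds_unique ((hJ' x).inner tendsto_const_nhds) ?_
    simp_rw [fun k => (hJ k).inner_comm x y]
    exact tendsto_const_nhds.inner (hJ' y)
  · exact le_of_tendsto_of_tendsto' ((hJ' x).inner (hJ' x)) ((hJ' x).inner tendsto_const_nhds)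
      fun k => (hJ k).firm x
  · refine tendsto_nhds_unique (hh x) ?_
    unfold quad
    exact (((tendsto_const_nhds.inner (tendsto_const_nhds.sub (hJ' x))).const_mul _).add
      (hp'.inner tendsto_const_nhds)).add hc

end Quad

/-! ### The Attouch-Wets distance -/

section Distance

open Filter Topology

variable {r : ℝ} {f g h : E n → EReal}

theorem exists_toReal_moreauEnv_eq_quad (hr : 0 < r) (hf : f ∈ S n) :
    ∃ J : E n →ₗ[ℝ] E n, IsFirm J ∧ ∃ p c, f = ofQuad r J p c ∧
      (fun x => (moreauEnv r f x).toReal) = quad r J p c := by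
  obtain ⟨J, hJ, p, c, rfl⟩ := exists_eq_ofQuad hr hf
  refine ⟨J, hJ, p, c, rfl, funext fun x => ?_⟩
  rw [moreauEnv_ofQuad hr hJ, EReal.toReal_coe]

theorem moreauEnv_ne_bot_and_ne_top (hr : 0 < r) (hf : f ∈ S n) (x : E n) :
    moreauEnv r f x ≠ ⊥ ∧ moreauEnv r f x ≠ ⊤ := by
  obtain ⟨J, hJ, p, c, rfl⟩ := exists_eq_ofQuad hr hf
  rw [moreauEnv_ofQuad hr hJ]
  exact ⟨EReal.coe_ne_bot _, EReal.coe_ne_top _⟩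

theorem bddAbove_envGap (hr : 0 < r) (hf : f ∈ S n) (hg : g ∈ S n) (R : ℝ) :
    BddAbove (envGap r f g '' Metric.closedBall 0 R) := by
  obtain ⟨J, -, p, c, -, h₁⟩ := exists_toReal_moreauEnv_eq_quad hr hf
  obtain ⟨J', -, p', c', -, h₂⟩ := exists_toReal_moreauEnv_eq_quad hr hg
  refine (isCompact_closedBall _ _).bddAbove_image (Continuous.continuousOn ?_)
  change Continuous fun x => |(fun x => (moreauEnv r f x).toReal) x -
    (fun x => (moreauEnv r g x).toReal) x|
  rw [h₁, h₂]
  exact ((continuous_quad _ _ _).sub (continuous_quad _ _ _)).abs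

theorem envGapSup_nonneg (i : ℕ) : 0 ≤ envGapSup r f g i := by
  refine Real.sSup_nonneg ?_
  rintro _ ⟨x, -, rfl⟩
  exact abs_nonneg _

theorem envGap_le_envGapSup (hr : 0 < r) (hf : f ∈ S n) (hg : g ∈ S n) {i : ℕ} {x : E n}
    (hx : ‖x‖ ≤ i) : envGap r f g x ≤ envGapSup r f g i :=
  le_csSup (bddAbove_envGap hr hf hg i) ⟨x, mem_closedBall_zero_iff.2 hx, rfl⟩

theorem envGapSup_le {i : ℕ} {C : ℝ} (hC : 0 ≤ C)
    (hx : ∀ x : E n, ‖x‖ ≤ i → envGap r f g x ≤ C) : envGapSup r f g i ≤ C := by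
  refine Real.sSup_le ?_ hC
  rintro _ ⟨x, hx', rfl⟩
  exact hx x (mem_closedBall_zero_iff.1 hx')

theorem awTerm_nonneg (i : ℕ) : 0 ≤ awTerm r f g i := by
  have := envGapSup_nonneg (r := r) (f := f) (g := g) i
  unfold awTerm
  positivity

/-- Valid for arbitrary `f` and `g`, because `envGapSup` is nonnegative even where `sSup` takes its
default value `0`. -/
theorem awTerm_le (i : ℕ) : awTerm r f g i ≤ 1 / 2 ^ i := by
  have := envGapSup_nonneg (r := r) (f := f) (g := g) i
  refine mul_le_of_le_one_right (by positivity) ?_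
  rw [div_le_one (by linarith)]
  linarith

theorem summable_one_div_two_pow_succ : Summable fun i : ℕ => (1 / 2 ^ (i + 1) : ℝ) := by
  simpa only [one_div, inv_pow] using
    (summable_nat_add_iff 1).2 (summable_geometric_of_lt_one (r := (2⁻¹ : ℝ)) (by norm_num)
      (by norm_num))

variable (r f g) in
theorem summable_awTerm : Summable fun i : ℕ => awTerm r f g (i + 1) :=
  summable_one_div_two_pow_succ.of_nonneg_of_le (fun _ => awTerm_nonneg _) fun _ => awTerm_le _

theorem awTerm_le_awDist (i : ℕ) : awTerm r f g (i + 1) ≤ awDist r f g :=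
  (summable_awTerm r f g).le_tsum i fun _ _ => awTerm_nonneg _

theorem envGap_comm (x : E n) : envGap r f g x = envGap r g f x := abs_sub_comm _ _

theorem awDist_comm (r : ℝ) (f g : E n → EReal) : awDist r f g = awDist r g f := by
  have : envGap r f g = envGap r g f := funext envGap_comm
  simp only [awDist, awTerm, envGapSup, this]

theorem awDist_self (r : ℝ) (f : E n → EReal) : awDist r f f = 0 := by
  have : ∀ i, envGapSup r f f i = 0 := fun i =>
    le_antisymm (envGapSup_le le_rfl fun x _ => by simp [envGap]) (envGapSup_nonneg i)
  simp [awDist, awTerm, this]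

theorem div_one_add_le_div_one_add {s t : ℝ} (hs : 0 ≤ s) (hst : s ≤ t) :
    s / (1 + s) ≤ t / (1 + t) := by
  rw [div_le_div_iff₀ (by linarith) (by linarith)]
  nlinarith

theorem add_div_one_add_le {s t : ℝ} (hs : 0 ≤ s) (ht : 0 ≤ t) :
    (s + t) / (1 + (s + t)) ≤ s / (1 + s) + t / (1 + t) := by
  rw [add_div]
  gcongr <;> linarith

theorem awDist_triangle (hr : 0 < r) (hf : f ∈ S n) (hg : g ∈ S n) (hh : h ∈ S n) :
    awDist r f h ≤ awDist r f g + awDist r g h := by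
  unfold awDist
  rw [← (summable_awTerm r f g).tsum_add (summable_awTerm r g h)]
  refine (summable_awTerm r f h).tsum_le_tsum (fun i => ?_)
    ((summable_awTerm r f g).add (summable_awTerm r g h))
  have h1 := envGapSup_nonneg (r := r) (f := f) (g := g) (i + 1)
  have h2 := envGapSup_nonneg (r := r) (f := g) (g := h) (i + 1)
  have h3 : envGapSup r f h (i + 1) ≤ envGapSup r f g (i + 1) + envGapSup r g h (i + 1) :=
    envGapSup_le (add_nonneg h1 h2) fun x hx => (abs_sub_le _ _ _).trans
      (add_le_add (envGap_le_envGapSup hr hf hg hx) (envGap_le_envGapSup hr hg hh hx))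
  unfold awTerm
  rw [← mul_add]
  exact mul_le_mul_of_nonneg_left ((div_one_add_le_div_one_add (envGapSup_nonneg _) h3).trans
    (add_div_one_add_le h1 h2)) (by positivity)

/-- If the supremum over the ball of radius `i + 1` were at least `ε`, the single term for that ball
would already reach the bound, as `t / (1 + t)` is increasing. -/
theorem envGap_lt_of_awDist_lt (hr : 0 < r) (hf : f ∈ S n) (hg : g ∈ S n) {i : ℕ} {ε : ℝ}
    (hε : 0 < ε) (hd : awDist r f g < 1 / 2 ^ (i + 1) * (ε / (1 + ε))) {x : E n}
    (hx : ‖x‖ ≤ (i + 1 : ℕ)) : envGap r f g x < ε := by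
  refine (envGap_le_envGapSup hr hf hg hx).trans_lt (lt_of_not_ge fun hle => ?_)
  refine hd.not_ge (le_trans ?_ (awTerm_le_awDist i))
  exact mul_le_mul_of_nonneg_left (div_one_add_le_div_one_add hε.le hle) (by positivity)

theorem eq_of_awDist_eq_zero (hr : 0 < r) (hf : f ∈ S n) (hg : g ∈ S n)
    (hd : awDist r f g = 0) : f = g := by
  have heq : (fun x => (moreauEnv r f x).toReal) = fun x => (moreauEnv r g x).toReal := by
    funext x
    obtain ⟨i, hi⟩ := exists_nat_ge ‖x‖
    have hx : ‖x‖ ≤ (i + 1 : ℕ) := hi.trans (by push_cast; linarith)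
    have : envGap r f g x ≤ 0 := le_of_forall_pos_le_add fun ε hε => by
      rw [zero_add]
      exact (envGap_lt_of_awDist_lt hr hf hg hε (by rw [hd]; positivity) hx).le
    exact sub_eq_zero.1 (abs_nonpos_iff.1 this)
  obtain ⟨J, hJ, p, c, rfl, h₁⟩ := exists_toReal_moreauEnv_eq_quad hr hf
  obtain ⟨J', hJ', p', c', rfl, h₂⟩ := exists_toReal_moreauEnv_eq_quad hr hg
  obtain ⟨rfl, rfl, rfl⟩ := quad_injective hr hJ hJ' (h₁.symm.trans (heq.trans h₂))
  rfl

/-- Each term tends to `0` and is dominated by a geometric series, so sum and limit can be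
exchanged. -/
theorem tendsto_awDist_zero {u : ℕ → E n → EReal}
    (hu : ∀ i : ℕ, ∀ ε > 0, ∀ᶠ k in atTop, ∀ x : E n, ‖x‖ ≤ i → envGap r (u k) f x ≤ ε) :
    Tendsto (fun k => awDist r (u k) f) atTop (𝓝 0) := by
  have hsup : ∀ i, Tendsto (fun k => envGapSup r (u k) f i) atTop (𝓝 0) := by
    intro i
    rw [Metric.tendsto_nhds]
    intro ε hε
    filter_upwards [hu i (ε / 2) (half_pos hε)] with k hk
    rw [Real.dist_0_eq_abs, abs_of_nonneg (envGapSup_nonneg i)]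
    exact (envGapSup_le (half_pos hε).le hk).trans_lt (half_lt_self hε)
  have hterm : ∀ i, Tendsto (fun k => awTerm r (u k) f (i + 1)) atTop (𝓝 0) := by
    intro i
    have := ((hsup (i + 1)).div ((hsup (i + 1)).const_add 1) (by norm_num)).const_mul
      (1 / 2 ^ (i + 1) : ℝ)
    simpa [awTerm] using this
  have := tendsto_tsum_of_dominated_convergence (f := fun k i => awTerm r (u k) f (i + 1))
    (g := fun _ => (0 : ℝ)) summable_one_div_two_pow_succ hterm
    (Eventually.of_forall fun k i => by
      rw [Real.norm_of_nonneg (awTerm_nonneg _)]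
      exact awTerm_le _)
  rwa [tsum_zero] at this

variable (n) in
/-- The Attouch-Wets metric on `S`. -/
abbrev awMetric (hr : 0 < r) : MetricSpace (S n) where
  dist f g := awDist r (f : E n → EReal) g
  dist_self f := awDist_self r f.1
  dist_comm f g := awDist_comm r f.1 g.1
  dist_triangle f g h := awDist_triangle hr f.2 g.2 h.2
  eq_of_dist_eq_zero {f g} h := Subtype.ext (eq_of_awDist_eq_zero hr f.2 g.2 h)

/-! ### Completeness -/

theorem completeSpace_awMetric (hr : 0 < r) :
    @CompleteSpace (S n) (awMetric n hr).toPseudoMetricSpace.toUniformSpace := by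
  let _ := awMetric n hr
  refine Metric.complete_of_cauchySeq_tendsto fun u hu => ?_
  have hgap : ∀ i : ℕ, ∀ ε > 0, ∃ N, ∀ k ≥ N, ∀ l ≥ N, ∀ x : E n, ‖x‖ ≤ i →
      envGap r (u k).1 (u l).1 x < ε := by
    intro i ε hε
    obtain ⟨N, hN⟩ := Metric.cauchySeq_iff.1 hu (1 / 2 ^ (i + 1) * (ε / (1 + ε))) (by positivity)
    exact ⟨N, fun k hk l hl x hx => envGap_lt_of_awDist_lt hr (u k).2 (u l).2 hε (hN k hk l hl)
      (hx.trans (by push_cast; linarith))⟩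
  have hlim : ∀ x, ∃ y, Tendsto (fun k => (moreauEnv r (u k).1 x).toReal) atTop (𝓝 y) := by
    intro x
    refine cauchySeq_tendsto_of_complete (Metric.cauchySeq_iff.2 fun ε hε => ?_)
    obtain ⟨i, hi⟩ := exists_nat_ge ‖x‖
    obtain ⟨N, hN⟩ := hgap i ε hε
    exact ⟨N, fun k hk l hl => hN k hk l hl x hi⟩
  choose h hh using hlim
  choose J hJ p c _ hquad using fun k => exists_toReal_moreauEnv_eq_quad hr (u k).2
  -- The pointwise limit of the envelopes is the envelope of a member of `S`, which is the candidate
  -- limit.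
  obtain ⟨J', hJ', p', c', rfl⟩ := exists_eq_quad_of_tendsto hr hJ (p := p) (c := c) (h := h)
    fun x => by simpa only [← hquad] using hh x
  refine ⟨⟨ofQuad r J' p' c', ofQuad_mem_S hr hJ' p' c'⟩, tendsto_iff_dist_tendsto_zero.2 ?_⟩
  refine tendsto_awDist_zero fun i ε hε => ?_
  obtain ⟨N, hN⟩ := hgap i ε hε
  filter_upwards [eventually_ge_atTop N] with k hk x hx
  unfold envGap
  rw [moreauEnv_ofQuad hr hJ', EReal.toReal_coe]
  -- Letting `l → ∞` in the Cauchy estimate, uniform on the ball, bounds the gap to the limit.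
  refine le_of_tendsto ((hh x).const_sub _).abs ?_
  filter_upwards [eventually_ge_atTop N] with l hl
  exact (hN k hk l hl x hx).le

end Distance

end

end GLQ

theorem mainTheorem9 (n : ℕ) (r : ℝ) (hr : 0 < r) :
    -- the distance is well defined on `S`: finite envelopes, finite suprema, convergent series
    (∀ f ∈ GLQ.S n, ∀ x : GLQ.E n, GLQ.moreauEnv r f x ≠ ⊥ ∧ GLQ.moreauEnv r f x ≠ ⊤) ∧
    (∀ f ∈ GLQ.S n, ∀ g ∈ GLQ.S n,
      (∀ i : ℕ, BddAbove (GLQ.envGap r f g '' Metric.closedBall 0 (i : ℝ))) ∧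
      Summable (fun i : ℕ => GLQ.awTerm r f g (i + 1))) ∧
    -- it is a metric on `S`, and a complete one
    (∃ m : MetricSpace (GLQ.S n),
      (∀ f g : GLQ.S n, m.dist f g = GLQ.awDist r (f : GLQ.E n → EReal) g) ∧
      @CompleteSpace (GLQ.S n) m.toPseudoMetricSpace.toUniformSpace) ∧
    -- conjugation
    (∀ f ∈ GLQ.S n, GLQ.conjugate f ∈ GLQ.S n) ∧
    (∀ f ∈ GLQ.S n,
      (∃ A ∈ GLQ.MaxMonoSymLin n, ∃ (a : GLQ.E n) (c : ℝ), f = GLQ.glq A a 0 c) →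
      GLQ.conjugate f ∈ GLQ.T n) ∧
    -- positive scaling
    (∀ f ∈ GLQ.S n, ∀ l : ℝ, 0 < l → (fun x => (l : EReal) * f x) ∈ GLQ.S n) ∧
    (∀ f ∈ GLQ.T n, ∀ l : ℝ, 0 < l → (fun x => (l : EReal) * f x) ∈ GLQ.T n) ∧
    -- addition
    (∀ f₁ ∈ GLQ.T n, ∀ f₂ ∈ GLQ.T n, (fun x => f₁ x + f₂ x) ∈ GLQ.T n) := by
  refine ⟨fun f hf => GLQ.moreauEnv_ne_bot_and_ne_top hr hf,
    fun f hf g hg => ⟨fun i => GLQ.bddAbove_envGap hr hf hg i, GLQ.summable_awTerm r f g⟩,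
    ⟨GLQ.awMetric n hr, fun f g => rfl, GLQ.completeSpace_awMetric hr⟩, ?_, ?_, ?_, ?_, ?_⟩
  · rintro _ ⟨⟨A, hA, a, b, c, rfl⟩, -⟩
    rw [GLQ.conjugate_glq hA]
    exact GLQ.glq_mem_S (GLQ.inv_mem_maxMonoSymLin hA) _ _ _
  · rintro _ - ⟨A, hA, a, c, rfl⟩
    -- Conjugation exchanges `a` and `b`, so `b = 0` becomes the center `0` required by `T`.
    rw [GLQ.conjugate_glq hA]
    exact GLQ.glq_mem_T (GLQ.inv_mem_maxMonoSymLin hA) _ _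
  · rintro _ ⟨⟨A, hA, a, b, c, rfl⟩, -⟩ l hl
    rw [GLQ.mul_glq hA a b c hl]
    exact GLQ.glq_mem_S (GLQ.scaleRel_mem_maxMonoSymLin hA hl) _ _ _
  · rintro _ ⟨⟨A, hA, b, c, rfl⟩, -⟩ l hl
    rw [GLQ.mul_glq hA 0 b c hl]
    exact GLQ.glq_mem_T (GLQ.scaleRel_mem_maxMonoSymLin hA hl) _ _
  · rintro _ ⟨⟨A, hA, b, c, rfl⟩, -⟩ _ ⟨⟨B, hB, b', c', rfl⟩, -⟩
    rw [GLQ.glq_add_glq hA hB 0 b b' c c']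
    exact GLQ.glq_mem_T (GLQ.addRel_mem_maxMonoSymLin hA hB) _ _
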